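/- Consider the operation symbols $\circ$ (binary, composition), $\wedge$ (binary, intersection), $D$, $R$ (unary, domain and range), $0$, $\mathrm{id}$ (constants), $A$ (unary, antidomain), $F$ (unary, fixset), $\triangleright$ (binary, preferential union), $\uparrow$ (unary, maximum iterate) and ${}^{-1}$ (unary, opposite). On partial functions on a set $X$, regarded as sets of pairs, they are interpreted as $f\circ g=\{(x,z):\exists y\,((x,y)\in f,\ (y,z)\in g)\}$; $f\wedge g=f\cap g$; $D(f)=\{(x,x):\exists y\,(x,y)\in f\}$; $R(f)=\{(y,y):\exists x\,(x,y)\in f\}$; $0=\emptyset$; $\mathrm{id}=\{(x,x):x\in X\}$; $A(f)=\{(x,x):x\in X,\ \nexists y\,(x,y)\in f\}$; $F(f)=\{(x,x):(x,x)\in f\}$; $f\triangleright g=f\cup\{(x,y)\in g: f \text{ is undefined at } x\}$; $f^{\uparrow}=\bigcup_{n\ge 0} f^n\circ A(f)$, where $f^0=\mathrm{id}$ and $f^{n+1}=f\circ f^n$; $f^{-1}=\{(y,x):(x,y)\in f \text{ and } x'=x \text{ whenever } (x',y)\in f\}$. For a set $\sigma$ of these symbols, an algebra of partial functions of signature $\sigma$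 with base $X$ is a set of partial functions on $X$, closed under the operations in $\sigma$ so interpreted, such that $X$ is the union of the domains and ranges of its members. A (nonempty) algebra $\mathcal A$ of signature $\sigma$ is representable by partial functions (over the base $X$) if it is isomorphic to an algebra of partial functions of signature $\sigma$ (with base $X$). **Corollary.** Let $\sigma$ be any signature with $\{\circ,\wedge,D,R\}\subseteq\sigma\subseteq\{\circ,\wedge,D,R,0,\mathrm{id},A,F,\triangleright,\uparrow,{}^{-1}\}$. Then representability of finite $\sigma$-algebras by partial functions is decidable: with finite $\sigma$-algebras on the sets $\{0,\dots,n\}$, $n\ge 0$, encoded by their number of elements and their operation tables, the set of codes of representable algebras is a computable set. Moreover there is a computable function $B:\mathbb N\to\mathbb N$ with $B(n)\le n^{n^{C\sqrt n}}$ for all $n\ge1$ and some constant $C$, such that every finite representable $\sigma$-algebra $\mathcal A$ is representable over a base with at most $B(|\mathcal A|)$ elements. -/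

import Mathlib

universe u v w

namespace PFRep

/-- The operation symbols `∘, ∧, D, R, 0, id, A, F, ⊳, ↑, ⁻¹`, in this order. -/
inductive Op : Type
  | comp | meet | dom | ran | zero | ident | antidom | fixset | pref | maxit | opp
  deriving DecidableEq

/-- The arity of an operation symbol. -/
def Op.arity : Op → ℕ
  | .comp => 2
  | .meet => 2
  | .dom => 1
  | .ran => 1
  | .zero => 0
  | .ident => 0
  | .antidom => 1
  | .fixset => 1
  | .pref => 2
  | .maxit => 1
  | .opp => 1

/-- The list of all operation symbols. -/
def Op.all : List Op :=
  [.comp, .meet, .dom, .ran, .zero, .ident, .antidom, .fixset, .pref, .maxit, .opp]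

/-- An (abstract) algebra of signature `σ` with domain `A`. No laws are imposed. -/
structure Alg (σ : Finset Op) (A : Type v) where
  op : ∀ s : Op, s ∈ σ → (Fin s.arity → A) → A

/-- Isomorphisms of `σ`-algebras. -/
structure Alg.Iso {σ : Finset Op} {A : Type v} {B : Type w} (𝔄 : Alg σ A) (𝔅 : Alg σ B) where
  toEquiv : A ≃ B
  map_op : ∀ (s : Op) (hs : s ∈ σ) (a : Fin s.arity → A),
    toEquiv (𝔄.op s hs a) = 𝔅.op s hs (fun i => toEquiv (a i))

section Concrete

variable {X : Type u}

/-- A set of pairs is (the graph of) a partial function. -/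
def IsPartialFunction (f : Set (X × X)) : Prop :=
  ∀ x y z, (x, y) ∈ f → (x, z) ∈ f → y = z

/-- Composition, `f` first and then `g`. -/
def comp (f g : Set (X × X)) : Set (X × X) :=
  {p | ∃ y, (p.1, y) ∈ f ∧ (y, p.2) ∈ g}

/-- The diagonal of the domain. -/
def dom (f : Set (X × X)) : Set (X × X) :=
  {p | p.1 = p.2 ∧ ∃ y, (p.1, y) ∈ f}

/-- The diagonal of the range. -/
def ran (f : Set (X × X)) : Set (X × X) :=
  {p | p.1 = p.2 ∧ ∃ x, (x, p.1) ∈ f}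

/-- The identity function on the base. -/
def ident : Set (X × X) :=
  {p | p.1 = p.2}

/-- The diagonal of the antidomain. -/
def antidom (f : Set (X × X)) : Set (X × X) :=
  {p | p.1 = p.2 ∧ ¬ ∃ y, (p.1, y) ∈ f}

/-- The diagonal of the set of fixed points. -/
def fixset (f : Set (X × X)) : Set (X × X) :=
  {p | p.1 = p.2 ∧ (p.1, p.1) ∈ f}

/-- Preferential union: `f x` if it is defined, otherwise `g x` if that is defined. -/
def pref (f g : Set (X × X)) : Set (X × X) :=
  {p | p ∈ f ∨ ((¬ ∃ y, (p.1, y) ∈ f) ∧ p ∈ g)}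

/-- Iterates: `f⁰ = id`, `fⁿ⁺¹ = f ∘ fⁿ`. -/
def iter (f : Set (X × X)) : ℕ → Set (X × X)
  | 0 => ident
  | n + 1 => comp f (iter f n)

/-- Maximum iterate. -/
def maxit (f : Set (X × X)) : Set (X × X) :=
  ⋃ n : ℕ, comp (iter f n) (antidom f)

/-- Opposite: `(y, x)` such that `x` is the unique point sent to `y` by `f`. -/
def opp (f : Set (X × X)) : Set (X × X) :=
  {p | (p.2, p.1) ∈ f ∧ ∀ x', (x', p.1) ∈ f → p.2 = x'}

/-- The set-theoretic interpretation, on the base `X`, of an operation symbol. -/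
def interp : (s : Op) → (Fin s.arity → Set (X × X)) → Set (X × X)
  | .comp, f => comp (f (0 : Fin 2)) (f (1 : Fin 2))
  | .meet, f => f (0 : Fin 2) ∩ f (1 : Fin 2)
  | .dom, f => dom (f (0 : Fin 1))
  | .ran, f => ran (f (0 : Fin 1))
  | .zero, _ => ∅
  | .ident, _ => ident
  | .antidom, f => antidom (f (0 : Fin 1))
  | .fixset, f => fixset (f (0 : Fin 1))
  | .pref, f => pref (f (0 : Fin 2)) (f (1 : Fin 2))
  | .maxit, f => maxit (f (0 : Fin 1))
  | .opp, f => opp (f (0 : Fin 1))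

end Concrete

/-- An algebra of partial functions of signature `σ` with base `X`: a set of partial functions,
closed under the set-theoretic operations in `σ`, such that `X` is the union of the domains and
ranges of its members. The base may be empty. -/
structure PFAlgebra (σ : Finset Op) (X : Type u) where
  carrier : Set (Set (X × X))
  isPartialFunction : ∀ f ∈ carrier, IsPartialFunction f
  closed : ∀ s ∈ σ, ∀ f : Fin s.arity → Set (X × X),
    (∀ i, f i ∈ carrier) → interp s f ∈ carrier
  base : ∀ x : X, ∃ f ∈ carrier, (∃ y, (x, y) ∈ f) ∨ (∃ y, (y, x) ∈ f)

/-- An algebra of partial functions as a `σ`-algebra. -/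
def PFAlgebra.toAlg {σ : Finset Op} {X : Type u} (𝔅 : PFAlgebra σ X) : Alg σ 𝔅.carrier where
  op s hs f := ⟨interp s (fun i => (f i : Set (X × X))), 𝔅.closed s hs _ (fun i => (f i).2)⟩

/-- `𝔄` is representable by partial functions over the base `X`. -/
def Alg.RepresentableOver {σ : Finset Op} {A : Type v} (𝔄 : Alg σ A) (X : Type u) : Prop :=
  ∃ 𝔅 : PFAlgebra σ X, Nonempty (𝔄.Iso 𝔅.toAlg)

/-- `𝔄` is representable by partial functions (over some base, of any cardinality). -/
def Alg.Representable {σ : Finset Op} {A : Type v} (𝔄 : Alg σ A) : Prop :=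
  ∃ X : Type u, 𝔄.RepresentableOver X

/-- Finite (nonempty) `σ`-algebras with domain `{0, …, n}`, as inputs to an algorithm. -/
structure FinAlg (σ : Finset Op) where
  n : ℕ
  alg : Alg σ (Fin (n + 1))

/-- The table of the operation `s`, where `m` is the number of elements: the entry in position
`a₀ + a₁ m + …` is the value of the operation at `(a₀, a₁, …)`. Empty if `s` is not in `σ`. -/
def FinAlg.table {σ : Finset Op} (𝔄 : FinAlg σ) (s : Op) : List ℕ :=
  if hs : s ∈ σ then
    List.ofFn fun i : Fin ((𝔄.n + 1) ^ s.arity) =>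
      ((𝔄.alg.op s hs (finFunctionFinEquiv.symm i) : Fin (𝔄.n + 1)) : ℕ)
  else []

/-- The encoding of a finite algebra: the number of its elements and its operation tables. -/
def FinAlg.code {σ : Finset Op} (𝔄 : FinAlg σ) : ℕ × List (List ℕ) :=
  (𝔄.n + 1, Op.all.map 𝔄.table)

/-- Distinct algebras have distinct encodings. -/
theorem FinAlg.code_injective {σ : Finset Op} :
    Function.Injective (FinAlg.code : FinAlg σ → ℕ × List (List ℕ)) := by
  rintro ⟨n, 𝔄⟩ ⟨m, 𝔅⟩ h
  obtain ⟨h1, h2⟩ := Prod.mk.inj h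
  obtain rfl : n = m := Nat.succ.inj h1
  congr
  obtain ⟨f⟩ := 𝔄
  obtain ⟨g⟩ := 𝔅
  congr
  funext s hs a
  have h3 := (List.map_inj_left.1 h2) s (by cases s <;> simp [Op.all])
  simp only [FinAlg.table, hs, dif_pos] at h3
  have h4 := congrFun (List.ofFn_injective h3) (finFunctionFinEquiv a)
  simpa using Fin.ext h4

end PFRep

/-! A representation `ρ` of an algebra with `n` elements may have an infinite base, but each point
`x` has at most `n` images, forming the set `reach ρ x`. Choose colours `c` that separate these
images and record, for each `a`, the colour of the image of `x` under `ρ a`, or `none`. These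
records are the points of a new finite base, on which `a` acts by `shift`: `y` goes to `b ↦ y (m a
b)`. All `x` and all admissible `c` are used.

Above one point, `reach ρ x` embeds as a set closed under the action (`simulates_shift`), so all
operations that look only forward are preserved (`Simulates.interp`). Range and opposite look
backward. For range, colours on `reach ρ x` extend to the images of any preimage of `x`, given at
least `n` colours (`exists_mk_mem_shift`). For opposite, a second preimage must stay visible: a
spare colour gives it two different records, which cannot both equal that of the first preimage
(`mem_opp_of_mk_mem_opp`).

With `2n - 1` colours the base has at most `(2n)^n - 1` points. Decidability follows by a bounded
search: a representation over `k` points is a number whose binary digits list the relations, and its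
correctness is a primitive recursive condition. -/

namespace PFRep

/-! ### Representations as maps, and transport along bijections of bases. -/

section Representations

variable {σ : Finset Op} {A : Type v} {X : Type u}

/-- `ρ` is an isomorphism of `𝔄` with an algebra of partial functions with base `X`. -/
structure Alg.IsRep (𝔄 : Alg σ A) (ρ : A → Set (X × X)) : Prop where
  injective : Function.Injective ρ
  isPartialFunction : ∀ a, IsPartialFunction (ρ a)
  map_op : ∀ (s : Op) (hs : s ∈ σ) (a : Fin s.arity → A),
    ρ (𝔄.op s hs a) = interp s (fun i => ρ (a i))
  base : ∀ x : X, ∃ a, (∃ y, (x, y) ∈ ρ a) ∨ ∃ y, (y, x) ∈ ρ a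

theorem Alg.representableOver_iff {𝔄 : Alg σ A} :
    𝔄.RepresentableOver X ↔ ∃ ρ : A → Set (X × X), 𝔄.IsRep ρ := by
  constructor
  · rintro ⟨𝔅, ⟨e⟩⟩
    refine ⟨fun a => e.toEquiv a, fun a b h => e.toEquiv.injective (Subtype.ext h),
      fun a => 𝔅.isPartialFunction _ (e.toEquiv a).2, fun s hs a => ?_, fun x => ?_⟩
    · exact congrArg Subtype.val (e.map_op s hs a)
    · obtain ⟨f, hf, h⟩ := 𝔅.base x
      exact ⟨e.toEquiv.symm ⟨f, hf⟩, by simpa using h⟩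
  · rintro ⟨ρ, h⟩
    refine ⟨⟨Set.range ρ, ?_, ?_, ?_⟩, ⟨⟨Equiv.ofInjective ρ h.injective, fun s hs a => ?_⟩⟩⟩
    · rintro _ ⟨a, rfl⟩
      exact h.isPartialFunction a
    · intro s hs f hf
      choose a ha using hf
      obtain rfl : (fun i => ρ (a i)) = f := funext ha
      exact ⟨_, h.map_op s hs a⟩
    · intro x
      obtain ⟨a, ha⟩ := h.base x
      exact ⟨_, ⟨a, rfl⟩, ha⟩
    · exact Subtype.ext (h.map_op s hs a)

theorem iter_preimage {Y : Type w} (e : Y ≃ X) (f : Set (X × X)) (n : ℕ) :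
    iter (Prod.map e e ⁻¹' f) n = Prod.map e e ⁻¹' iter f n := by
  induction n with
  | zero => ext ⟨x, y⟩; simp [iter, ident]
  | succ n ih =>
    ext ⟨x, y⟩
    simp [iter, comp, ih,
      ← e.surjective.exists (p := fun z => (e x, z) ∈ f ∧ (z, e y) ∈ iter f n)]

theorem interp_preimage {Y : Type w} (e : Y ≃ X) (s : Op) (f : Fin s.arity → Set (X × X)) :
    interp s (fun i => Prod.map e e ⁻¹' f i) = Prod.map e e ⁻¹' interp s f := by
  ext ⟨x, y⟩
  cases s <;>
    simp [interp, comp, dom, ran, ident, antidom, fixset, pref, maxit, opp, iter_preimage,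
      e.surjective.exists, e.surjective.forall]

theorem Alg.IsRep.preimage {Y : Type w} {𝔄 : Alg σ A} {ρ : A → Set (X × X)} (h : 𝔄.IsRep ρ)
    (e : Y ≃ X) : 𝔄.IsRep (fun a => Prod.map e e ⁻¹' ρ a) where
  injective a b hab :=
    h.injective (Set.preimage_injective.2 (e.surjective.prodMap e.surjective) hab)
  isPartialFunction a x y z hy hz := e.injective (h.isPartialFunction a _ _ _ hy hz)
  map_op s hs a := by rw [interp_preimage, h.map_op]
  base y := by simpa [e.surjective.exists] using h.base (e y)

theorem Alg.RepresentableOver.of_equiv {Y : Type w} {𝔄 : Alg σ A}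
    (h : 𝔄.RepresentableOver X) (e : Y ≃ X) : 𝔄.RepresentableOver Y := by
  obtain ⟨ρ, hρ⟩ := Alg.representableOver_iff.1 h
  exact Alg.representableOver_iff.2 ⟨_, hρ.preimage e⟩

end Representations

/-! ### Bounded morphisms and the operations that they respect. -/

section Simulation

variable {X : Type u} {Y : Type w}

/-- `S` is closed under `f`, and `Φ` is a bounded morphism from the restriction of `f` to `S`
to `g`. -/
structure Simulates {S : Set X} (Φ : S → Y) (f : Set (X × X)) (g : Set (Y × Y)) : Prop where
  closed : ∀ x ∈ S, ∀ y, (x, y) ∈ f → y ∈ S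
  mem_iff : ∀ (x : S) (z : Y), (Φ x, z) ∈ g ↔ ∃ y : S, (x.1, y.1) ∈ f ∧ Φ y = z

variable {S : Set X} {Φ : S → Y} {f f₁ f₂ : Set (X × X)} {g g₁ g₂ : Set (Y × Y)}

theorem Simulates.exists_iff (h : Simulates Φ f g) (x : S) :
    (∃ z, (Φ x, z) ∈ g) ↔ ∃ y, (x.1, y) ∈ f := by
  constructor
  · rintro ⟨z, hz⟩
    obtain ⟨y, hy, -⟩ := (h.mem_iff x z).1 hz
    exact ⟨y, hy⟩
  · rintro ⟨y, hy⟩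
    exact ⟨_, (h.mem_iff x _).2 ⟨⟨y, h.closed _ x.2 _ hy⟩, hy, rfl⟩⟩

/-- Subsets of the identity given by a pointwise condition that `Φ` respects. -/
theorem Simulates.of_diagonal {p : X → Prop} {q : Y → Prop} (h : ∀ x : S, q (Φ x) ↔ p x) :
    Simulates Φ {t | t.1 = t.2 ∧ p t.1} {t | t.1 = t.2 ∧ q t.1} where
  closed := by
    rintro x hx y ⟨hxy, -⟩
    exact (show x = y from hxy) ▸ hx
  mem_iff x z := by
    constructor
    · rintro ⟨hz, hq⟩
      exact ⟨x, ⟨rfl, (h x).1 hq⟩, hz⟩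
    · rintro ⟨y, ⟨hxy, hp⟩, rfl⟩
      obtain rfl : x = y := Subtype.ext hxy
      exact ⟨rfl, (h x).2 hp⟩

theorem Simulates.ident : Simulates Φ ident ident := by
  simpa [PFRep.ident] using Simulates.of_diagonal (Φ := Φ) (p := fun _ => True) (q := fun _ => True)
    (by simp)

theorem Simulates.empty : Simulates Φ ∅ ∅ := ⟨by simp, by simp⟩

theorem Simulates.comp (h₁ : Simulates Φ f₁ g₁) (h₂ : Simulates Φ f₂ g₂) :
    Simulates Φ (comp f₁ f₂) (comp g₁ g₂) where
  closed := by
    rintro x hx y ⟨z, hz, hy⟩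
    exact h₂.closed _ (h₁.closed _ hx _ hz) _ hy
  mem_iff x z := by
    constructor
    · rintro ⟨w, hw, hz⟩
      obtain ⟨y, hy, rfl⟩ := (h₁.mem_iff _ _).1 hw
      obtain ⟨t, ht, rfl⟩ := (h₂.mem_iff _ _).1 hz
      exact ⟨t, ⟨y, hy, ht⟩, rfl⟩
    · rintro ⟨t, ⟨y, hy, ht⟩, rfl⟩
      exact ⟨Φ ⟨y, h₁.closed _ x.2 _ hy⟩, (h₁.mem_iff _ _).2 ⟨⟨y, _⟩, hy, rfl⟩,
        (h₂.mem_iff _ _).2 ⟨t, ht, rfl⟩⟩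

theorem Simulates.inter (hΦ : Function.Injective Φ) (h₁ : Simulates Φ f₁ g₁)
    (h₂ : Simulates Φ f₂ g₂) : Simulates Φ (f₁ ∩ f₂) (g₁ ∩ g₂) where
  closed x hx y hy := h₁.closed x hx y hy.1
  mem_iff x z := by
    constructor
    · rintro ⟨hz₁, hz₂⟩
      obtain ⟨y, hy, rfl⟩ := (h₁.mem_iff _ _).1 hz₁
      obtain ⟨t, ht, hty⟩ := (h₂.mem_iff _ _).1 hz₂
      obtain rfl := hΦ hty
      exact ⟨t, ⟨hy, ht⟩, rfl⟩
    · rintro ⟨y, ⟨hy₁, hy₂⟩, rfl⟩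
      exact ⟨(h₁.mem_iff _ _).2 ⟨y, hy₁, rfl⟩, (h₂.mem_iff _ _).2 ⟨y, hy₂, rfl⟩⟩

theorem Simulates.dom (h : Simulates Φ f g) : Simulates Φ (dom f) (dom g) :=
  .of_diagonal (p := fun x => ∃ y, (x, y) ∈ f) (q := fun x => ∃ y, (x, y) ∈ g) h.exists_iff

theorem Simulates.antidom (h : Simulates Φ f g) : Simulates Φ (antidom f) (antidom g) :=
  .of_diagonal (p := fun x => ¬ ∃ y, (x, y) ∈ f) (q := fun x => ¬ ∃ y, (x, y) ∈ g)
    fun x => not_congr (h.exists_iff x)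

theorem Simulates.fixset (hΦ : Function.Injective Φ) (h : Simulates Φ f g) :
    Simulates Φ (fixset f) (fixset g) := by
  refine .of_diagonal (p := fun x => (x, x) ∈ f) (q := fun x => (x, x) ∈ g)
    fun x => (h.mem_iff x _).trans ⟨?_, fun hx => ⟨x, hx, rfl⟩⟩
  rintro ⟨y, hy, hyx⟩
  obtain rfl := hΦ hyx
  exact hy

theorem Simulates.pref (h₁ : Simulates Φ f₁ g₁) (h₂ : Simulates Φ f₂ g₂) :
    Simulates Φ (pref f₁ f₂) (pref g₁ g₂) where
  closed := by
    rintro x hx y (hy | ⟨-, hy⟩)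
    exacts [h₁.closed _ hx _ hy, h₂.closed _ hx _ hy]
  mem_iff x z := by
    change ((Φ x, z) ∈ g₁ ∨ (¬ ∃ y, (Φ x, y) ∈ g₁) ∧ (Φ x, z) ∈ g₂) ↔
      ∃ y : S, ((x.1, y.1) ∈ f₁ ∨ (¬ ∃ y, (x.1, y) ∈ f₁) ∧ (x.1, y.1) ∈ f₂) ∧ Φ y = z
    rw [h₁.exists_iff, h₁.mem_iff, h₂.mem_iff]
    constructor
    · rintro (⟨y, hy, rfl⟩ | ⟨h, y, hy, rfl⟩)
      exacts [⟨y, .inl hy, rfl⟩, ⟨y, .inr ⟨h, hy⟩, rfl⟩]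
    · rintro ⟨y, hy | ⟨h, hy⟩, rfl⟩
      exacts [.inl ⟨y, hy, rfl⟩, .inr ⟨h, y, hy, rfl⟩]

theorem Simulates.iUnion {ι : Type*} {f : ι → Set (X × X)} {g : ι → Set (Y × Y)}
    (h : ∀ i, Simulates Φ (f i) (g i)) : Simulates Φ (⋃ i, f i) (⋃ i, g i) where
  closed x hx y hy := by
    obtain ⟨i, hi⟩ := Set.mem_iUnion.1 hy
    exact (h i).closed x hx y hi
  mem_iff x z := by
    simp only [Set.mem_iUnion, (h _).mem_iff]
    constructor
    · rintro ⟨i, y, hy, rfl⟩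
      exact ⟨y, ⟨i, hy⟩, rfl⟩
    · rintro ⟨y, ⟨i, hy⟩, rfl⟩
      exact ⟨i, y, hy, rfl⟩

theorem Simulates.iter (h : Simulates Φ f g) (n : ℕ) : Simulates Φ (iter f n) (iter g n) := by
  induction n with
  | zero => exact .ident
  | succ n ih => exact h.comp ih

theorem Simulates.maxit (h : Simulates Φ f g) : Simulates Φ (maxit f) (maxit g) :=
  .iUnion fun n => (h.iter n).comp h.antidom

/-- Range and opposite depend on preimages, which may lie outside a forward-closed set, so they are
excluded. Injectivity of `Φ` matters only for intersection and fixset, which compare points. -/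
theorem Simulates.interp (hΦ : Function.Injective Φ) (s : Op) (hs₁ : s ≠ .ran) (hs₂ : s ≠ .opp)
    {f : Fin s.arity → Set (X × X)} {g : Fin s.arity → Set (Y × Y)}
    (h : ∀ i, Simulates Φ (f i) (g i)) : Simulates Φ (interp s f) (interp s g) := by
  cases s with
  | comp => exact (h (0 : Fin 2)).comp (h (1 : Fin 2))
  | meet => exact (h (0 : Fin 2)).inter hΦ (h (1 : Fin 2))
  | dom => exact (h (0 : Fin 1)).dom
  | ran => exact absurd rfl hs₁
  | zero => exact .empty
  | ident => exact .ident
  | antidom => exact (h (0 : Fin 1)).antidom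
  | fixset => exact (h (0 : Fin 1)).fixset hΦ
  | pref => exact (h (0 : Fin 2)).pref (h (1 : Fin 2))
  | maxit => exact (h (0 : Fin 1)).maxit
  | opp => exact absurd rfl hs₂

end Simulation

/-! ### Records of colours as points of a new base. -/

theorem exists_injOn_extension {X K : Type*} [Fintype K] [Nonempty K] {S T : Set X} (hST : S ⊆ T)
    (hT : T.Finite) (hK : T.ncard ≤ Fintype.card K) {c : X → K} (hc : S.InjOn c) :
    ∃ c' : X → K, T.InjOn c' ∧ S.EqOn c c' := by
  classical
  have := hT.fintype
  have hcard : Fintype.card T = T.ncard := by rw [Set.ncard_eq_toFinset_card', Set.toFinset_card]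
  have hS : Set.InjOn (fun x : T => c x) (Subtype.val ⁻¹' S) :=
    fun x hx y hy h => Subtype.ext (hc hx hy h)
  -- The colours used on `S` are padded to exactly `|T|` colours, so that the injection on `S`
  -- extends to a bijection from `T`.
  obtain ⟨t, ht, htc⟩ := Finset.exists_subsuperset_card_eq (n := Fintype.card T)
    (Finset.subset_univ ((Subtype.val ⁻¹' S : Set T).toFinset.image fun x : T => c x))
    (Finset.card_image_le.trans (Finset.card_le_univ _)) (by rwa [Finset.card_univ, hcard])
  obtain ⟨g, hg⟩ := Set.MapsTo.exists_equiv_extend_of_card_eq (α := T) htc.2.symm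
    (s := Subtype.val ⁻¹' S) (f := fun x : T => c x)
    (fun x hx => ht (Finset.mem_image_of_mem _ (Set.mem_toFinset.2 hx))) hS
  refine ⟨fun x => if h : x ∈ T then g ⟨x, h⟩ else c x, fun x hx y hy h => ?_, fun x hx => ?_⟩
  · simp only [hx, hy, dif_pos] at h
    exact congrArg Subtype.val (g.injective (Subtype.ext h))
  · simp only [hST hx, dif_pos]
    exact (hg ⟨x, hST hx⟩ hx).symm

section Colouring

variable {A : Type v} {X : Type u} {K : Type} {ρ : A → Set (X × X)} {m : A → A → A}

/-- The points that are images of `x`. -/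
def reach (ρ : A → Set (X × X)) (x : X) : Set X := {z | ∃ a, (x, z) ∈ ρ a}

open Classical in
/-- The colours of the images of `x`. -/
noncomputable def colouring (ρ : A → Set (X × X)) (c : X → K) (x : X) (a : A) : Option K :=
  if h : ∃ z, (x, z) ∈ ρ a then some (c h.choose) else none

/-- The colourings obtained from colours that separate the images of a point. -/
def Coloured (ρ : A → Set (X × X)) (K : Type) : Type v :=
  {y : A → Option K // ∃ x c, (reach ρ x).InjOn c ∧ y = colouring ρ c x}

/-- The partial function of `a` on colourings. -/
def shift (ρ : A → Set (X × X)) (K : Type) (m : A → A → A) (a : A) :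
    Set (Coloured ρ K × Coloured ρ K) :=
  {p | (p.1.1 a).isSome ∧ ∀ b, p.2.1 b = p.1.1 (m a b)}

theorem reach_trans (hm : ∀ a b, ρ (m a b) = comp (ρ a) (ρ b)) {x z : X} (hz : z ∈ reach ρ x) :
    reach ρ z ⊆ reach ρ x := by
  rintro t ⟨b, hb⟩
  obtain ⟨a, ha⟩ := hz
  exact ⟨m a b, hm a b ▸ ⟨z, ha, hb⟩⟩

theorem mem_reach_self (hid : ∀ x, ∃ a, (x, x) ∈ ρ a ∧ ρ a ⊆ ident) (x : X) : x ∈ reach ρ x :=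
  let ⟨a, ha, _⟩ := hid x; ⟨a, ha⟩

/-- An element of `A` sending `x` to `z` determines `z`, so choosing one for each image is
injective. -/
theorem finite_reach [Finite A] (hρ : ∀ a, IsPartialFunction (ρ a)) (x : X) :
    (reach ρ x).Finite ∧ (reach ρ x).ncard ≤ Nat.card A := by
  choose f hf using fun z : reach ρ x => z.2
  have hinj : Function.Injective f := fun y z h =>
    Subtype.ext (hρ _ _ _ _ (hf y) (h ▸ hf z))
  exact ⟨Set.finite_coe_iff.1 (Finite.of_injective f hinj),
    Nat.card_le_card_of_injective f hinj⟩

theorem colouring_eq_some_iff (hρ : ∀ a, IsPartialFunction (ρ a)) {c : X → K} {x : X} {a : A}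
    {k : K} : colouring ρ c x a = some k ↔ ∃ z, (x, z) ∈ ρ a ∧ c z = k := by
  unfold colouring
  split_ifs with h
  · rw [Option.some_inj]
    constructor
    · rintro rfl
      exact ⟨_, h.choose_spec, rfl⟩
    · rintro ⟨z, hz, rfl⟩
      rw [hρ a _ _ _ h.choose_spec hz]
  · simp only [false_iff, not_exists, not_and]
    exact fun z hz => absurd ⟨z, hz⟩ h

theorem colouring_of_mem (hρ : ∀ a, IsPartialFunction (ρ a)) {c : X → K} {x z : X} {a : A}
    (h : (x, z) ∈ ρ a) : colouring ρ c x a = some (c z) :=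
  (colouring_eq_some_iff hρ).2 ⟨z, h, rfl⟩

theorem isSome_colouring {c : X → K} {x : X} {a : A} :
    (colouring ρ c x a).isSome ↔ ∃ z, (x, z) ∈ ρ a := by
  unfold colouring
  split_ifs with h <;> simpa using h

theorem colouring_congr (hρ : ∀ a, IsPartialFunction (ρ a)) {c c' : X → K} {x : X}
    (h : (reach ρ x).EqOn c c') : colouring ρ c x = colouring ρ c' x := by
  ext a k
  simp only [colouring_eq_some_iff hρ]
  refine exists_congr fun z => and_congr_right fun hz => ?_
  rw [h ⟨a, hz⟩]

/-- The record of an image of `x` can be read off that of `x`; this is the rule defining `shift`. -/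
theorem colouring_comp (hρ : ∀ a, IsPartialFunction (ρ a))
    (hm : ∀ a b, ρ (m a b) = comp (ρ a) (ρ b)) {c : X → K} {x z : X} {a : A} (h : (x, z) ∈ ρ a)
    (b : A) : colouring ρ c x (m a b) = colouring ρ c z b := by
  ext k
  simp only [colouring_eq_some_iff hρ, hm]
  constructor
  · rintro ⟨t, ⟨w, hw, ht⟩, rfl⟩
    obtain rfl : z = w := hρ a _ _ _ h hw
    exact ⟨t, ht, rfl⟩
  · rintro ⟨t, ht, rfl⟩
    exact ⟨t, ⟨z, h, ht⟩, rfl⟩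

/-- A subidentity element defined at `y` puts the colour of `y` itself into its record. A point with
the same record is fixed by that element too, hence has the same colour. -/
theorem colouring_injOn (hρ : ∀ a, IsPartialFunction (ρ a))
    (hid : ∀ x, ∃ a, (x, x) ∈ ρ a ∧ ρ a ⊆ ident) {c : X → K} {x : X} (hc : (reach ρ x).InjOn c) :
    (reach ρ x).InjOn (colouring ρ c) := by
  intro y hy z hz h
  obtain ⟨a, ha, hai⟩ := hid y
  have h1 := congrFun h a
  rw [colouring_of_mem hρ ha] at h1
  obtain ⟨w, hw, hwc⟩ := (colouring_eq_some_iff hρ).1 h1.symm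
  obtain rfl : z = w := hai hw
  exact hc hy hz hwc.symm

theorem isPartialFunction_shift (a : A) : IsPartialFunction (shift ρ K m a) :=
  fun _ _ _ h h' => Subtype.ext (funext fun b => (h.2 b).trans (h'.2 b).symm)

/-- The point of `Coloured ρ K` above a point. -/
noncomputable def Coloured.mk {x : X} {c : X → K} (hc : (reach ρ x).InjOn c) : Coloured ρ K :=
  ⟨colouring ρ c x, x, c, hc, rfl⟩

theorem mk_mem_shift (hρ : ∀ a, IsPartialFunction (ρ a))
    (hm : ∀ a b, ρ (m a b) = comp (ρ a) (ρ b)) {c : X → K} {x z : X} {a : A}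
    (hx : (reach ρ x).InjOn c) (hz : (reach ρ z).InjOn c) (h : (x, z) ∈ ρ a) :
    (Coloured.mk hx, Coloured.mk hz) ∈ shift ρ K m a :=
  ⟨isSome_colouring.2 ⟨z, h⟩, fun b => (colouring_comp hρ hm h b).symm⟩

/-- Going forward, the same `c` still works, since `reach` only shrinks. -/
theorem exists_of_mem_shift (hρ : ∀ a, IsPartialFunction (ρ a))
    (hm : ∀ a b, ρ (m a b) = comp (ρ a) (ρ b)) {c : X → K} {x : X} {a : A}
    (hx : (reach ρ x).InjOn c) {t : Coloured ρ K} (h : (Coloured.mk hx, t) ∈ shift ρ K m a) :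
    ∃ (z : X) (hz : (reach ρ z).InjOn c), (x, z) ∈ ρ a ∧ Coloured.mk hz = t := by
  obtain ⟨z, hz⟩ := isSome_colouring.1 h.1
  have hzc := hx.mono (reach_trans hm ⟨a, hz⟩)
  exact ⟨z, hzc, hz, isPartialFunction_shift a _ _ _ (mk_mem_shift hρ hm hx hzc hz) h⟩

/-- The points of `Coloured ρ K` above the images of a point. -/
noncomputable def Coloured.lift (hm : ∀ a b, ρ (m a b) = comp (ρ a) (ρ b)) {x : X} {c : X → K}
    (hc : (reach ρ x).InjOn c) (z : reach ρ x) : Coloured ρ K :=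
  .mk (hc.mono (reach_trans hm z.2))

theorem lift_injective (hρ : ∀ a, IsPartialFunction (ρ a))
    (hm : ∀ a b, ρ (m a b) = comp (ρ a) (ρ b))
    (hid : ∀ x, ∃ a, (x, x) ∈ ρ a ∧ ρ a ⊆ ident) {c : X → K} {x : X} (hc : (reach ρ x).InjOn c) :
    Function.Injective (Coloured.lift hm hc) := fun y z h =>
  Subtype.ext (colouring_injOn hρ hid hc y.2 z.2 (congrArg Subtype.val h))

theorem simulates_shift (hρ : ∀ a, IsPartialFunction (ρ a))
    (hm : ∀ a b, ρ (m a b) = comp (ρ a) (ρ b)) {c : X → K} {x : X} (hc : (reach ρ x).InjOn c)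
    (a : A) : Simulates (Coloured.lift hm hc) (ρ a) (shift ρ K m a) where
  closed y hy z hz := reach_trans hm hy ⟨a, hz⟩
  mem_iff y t := by
    constructor
    · intro h
      obtain ⟨z, hz, hyz, rfl⟩ := exists_of_mem_shift hρ hm _ h
      exact ⟨⟨z, reach_trans hm y.2 ⟨a, hyz⟩⟩, hyz, rfl⟩
    · rintro ⟨z, hz, rfl⟩
      exact mk_mem_shift hρ hm _ _ hz

variable [Fintype K] [Nonempty K] [Finite A]

theorem exists_injOn_reach (hρ : ∀ a, IsPartialFunction (ρ a))
    (hK : Nat.card A ≤ Fintype.card K) (x : X) : ∃ c : X → K, (reach ρ x).InjOn c := by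
  obtain ⟨c, hc, -⟩ := exists_injOn_extension (Set.empty_subset _) (finite_reach hρ x).1
    ((finite_reach hρ x).2.trans hK) (c := fun _ => Classical.arbitrary K) (Set.injOn_empty _)
  exact ⟨c, hc⟩

/-- Preimages of a point lift to colourings. -/
theorem exists_mk_mem_shift (hρ : ∀ a, IsPartialFunction (ρ a))
    (hm : ∀ a b, ρ (m a b) = comp (ρ a) (ρ b)) (hK : Nat.card A ≤ Fintype.card K)
    {c : X → K} {x z : X} {a : A} (hc : (reach ρ x).InjOn c) (h : (z, x) ∈ ρ a) :
    ∃ (c' : X → K) (hc' : (reach ρ z).InjOn c'), (reach ρ x).EqOn c c' ∧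
      (Coloured.mk hc', Coloured.mk hc) ∈ shift ρ K m a := by
  obtain ⟨c', hc', he⟩ := exists_injOn_extension (reach_trans hm ⟨a, h⟩) (finite_reach hρ z).1
    ((finite_reach hρ z).2.trans hK) hc
  refine ⟨c', hc', he, ?_⟩
  -- A record depends only on the colours on `reach ρ x`, so `c` may be replaced by its extension.
  have : Coloured.mk hc = Coloured.mk (hc'.mono (reach_trans hm ⟨a, h⟩)) :=
    Subtype.ext (colouring_congr hρ he)
  rw [this]
  exact mk_mem_shift hρ hm hc' _ h

/-- A preimage of the record may lie above a point `y` with an image `z` other than `x`. As `z` and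
`x` share a record, definedness of `r` carries over from one to the other. -/
theorem exists_mem_shift_iff (hρ : ∀ a, IsPartialFunction (ρ a))
    (hm : ∀ a b, ρ (m a b) = comp (ρ a) (ρ b)) (hK : Nat.card A ≤ Fintype.card K)
    {c : X → K} {x : X} {a r : A} (hc : (reach ρ x).InjOn c) (hr : ρ r = ran (ρ a)) :
    (∃ t, (t, Coloured.mk hc) ∈ shift ρ K m a) ↔ ∃ z, (z, x) ∈ ρ a := by
  constructor
  · rintro ⟨⟨_, y, c', hc', rfl⟩, h⟩
    obtain ⟨z, hz, hyz, hzt⟩ := exists_of_mem_shift hρ hm hc' h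
    have h1 : (colouring ρ c' z r).isSome := isSome_colouring.2 ⟨z, hr ▸ ⟨rfl, y, hyz⟩⟩
    rw [show colouring ρ c' z = colouring ρ c x from congrArg Subtype.val hzt] at h1
    obtain ⟨w, hw⟩ := isSome_colouring.1 h1
    rw [hr] at hw
    exact hw.2
  · rintro ⟨z, hz⟩
    obtain ⟨c', hc', -, h⟩ := exists_mk_mem_shift hρ hm hK hc hz
    exact ⟨_, h⟩

theorem simulates_ran (hρ : ∀ a, IsPartialFunction (ρ a))
    (hm : ∀ a b, ρ (m a b) = comp (ρ a) (ρ b)) (hK : Nat.card A ≤ Fintype.card K)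
    {c : X → K} {x : X} {a r : A} (hc : (reach ρ x).InjOn c) (hr : ρ r = ran (ρ a)) :
    Simulates (Coloured.lift hm hc) (ran (ρ a)) (ran (shift ρ K m a)) :=
  .of_diagonal (p := fun y => ∃ z, (z, y) ∈ ρ a) (q := fun y => ∃ z, (z, y) ∈ shift ρ K m a)
    fun _ => exists_mem_shift_iff hρ hm hK _ hr

/-- If a lift of an edge is the only one into its target, so is the edge. -/
theorem mem_opp_of_mk_mem_opp (hρ : ∀ a, IsPartialFunction (ρ a))
    (hm : ∀ a b, ρ (m a b) = comp (ρ a) (ρ b)) (hid : ∀ x, ∃ a, (x, x) ∈ ρ a ∧ ρ a ⊆ ident)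
    (hK : Nat.card A ≤ Fintype.card K) (hK₂ : 2 ≤ Nat.card A → Nat.card A < Fintype.card K)
    {c : X → K} {x z : X} {a : A} (hx : (reach ρ x).InjOn c) (hz : (reach ρ z).InjOn c)
    (hxz : (x, z) ∈ ρ a) (h : (Coloured.mk hz, Coloured.mk hx) ∈ opp (shift ρ K m a)) :
    (z, x) ∈ opp (ρ a) := by
  classical
  refine ⟨hxz, fun y (hyz : (y, z) ∈ ρ a) => ?_⟩
  -- If `y` is an image of `z`, then `c` already colours its images, and both `x` and `y` lie in
  -- `reach ρ z`, where records are distinct.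
  by_cases hy : y ∈ reach ρ z
  · have h1 := h.2 _ (mk_mem_shift hρ hm (hz.mono (reach_trans hm hy)) hz hyz)
    exact colouring_injOn hρ hid hx (mem_reach_self hid x) (reach_trans hm ⟨a, hxz⟩ hy)
      (congrArg Subtype.val h1)
  · exfalso
    -- Every admissible extension of `c` to the images of `y` yields a preimage of the record of
    -- `z`, which uniqueness identifies with the record of `x`.
    have key (c' : X → K) (hc' : (reach ρ y).InjOn c') (he : (reach ρ z).EqOn c c') :
        colouring ρ c x = colouring ρ c' y := by
      have hz' : Coloured.mk hz = Coloured.mk (hc'.mono (reach_trans hm ⟨a, hyz⟩)) :=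
        Subtype.ext (colouring_congr hρ he)
      refine congrArg Subtype.val (h.2 (Coloured.mk hc') ?_)
      rw [hz']
      exact mk_mem_shift hρ hm hc' (hc'.mono (reach_trans hm ⟨a, hyz⟩)) hyz
    obtain ⟨c', hc', he, -⟩ := exists_mk_mem_shift hρ hm hK hz hyz
    obtain ⟨hfin, hcard⟩ := finite_reach hρ y
    -- Both `y` and `z` belong to `reach ρ y` and they differ, so there are at least two elements
    -- and a colour is left over.
    have h2 : 2 ≤ Nat.card A := by
      refine le_trans ?_ hcard
      rw [← Set.ncard_pair (a := y) (b := z) fun hyz' => hy (hyz' ▸ mem_reach_self hid y)]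
      exact Set.ncard_le_ncard (by
        rintro t (rfl | rfl)
        exacts [mem_reach_self hid _, ⟨a, hyz⟩]) hfin
    obtain ⟨k, hk⟩ : ∃ k, k ∉ c' '' reach ρ y := by
      by_contra! hall
      have := (Set.ncard_image_le (f := c') hfin).trans hcard
      rw [Set.eq_univ_of_forall hall, Set.ncard_univ, Nat.card_eq_fintype_card] at this
      exact absurd (hK₂ h2) (not_lt.2 this)
    have h3 := key c' hc' he
    -- Recolouring `y` alone keeps the colours on `reach ρ z` but changes the record of `y`, while
    -- both records must equal that of `x`.
    have h4 := key (Function.update c' y k) (by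
      intro s hs t ht hst
      by_cases hsy : s = y <;> by_cases hty : t = y
      · rw [hsy, hty]
      · subst hsy
        rw [Function.update_self, Function.update_of_ne hty] at hst
        exact absurd ⟨t, ht, hst.symm⟩ hk
      · subst hty
        rw [Function.update_self, Function.update_of_ne hsy] at hst
        exact absurd ⟨s, hs, hst⟩ hk
      · rw [Function.update_of_ne hsy, Function.update_of_ne hty] at hst
        exact hc' hs ht hst) (fun t ht => by
      rw [Function.update_of_ne (by rintro rfl; exact hy ht)]
      exact he ht)
    obtain ⟨e, he, -⟩ := hid y
    have h5 := congrFun (h3.symm.trans h4) e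
    rw [colouring_of_mem hρ he, colouring_of_mem hρ he, Function.update_self, Option.some_inj] at h5
    exact hk ⟨y, ⟨e, he⟩, h5⟩

/-- Distinct points may share a record. The element `r` transfers opposite edges between them,
because the action of `r` on a record does not depend on the point below it. -/
theorem simulates_opp (hρ : ∀ a, IsPartialFunction (ρ a))
    (hm : ∀ a b, ρ (m a b) = comp (ρ a) (ρ b)) (hid : ∀ x, ∃ a, (x, x) ∈ ρ a ∧ ρ a ⊆ ident)
    (hK : Nat.card A ≤ Fintype.card K) (hK₂ : 2 ≤ Nat.card A → Nat.card A < Fintype.card K)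
    {c : X → K} {x : X} {a r : A} (hc : (reach ρ x).InjOn c) (hr : ρ r = opp (ρ a)) :
    Simulates (Coloured.lift hm hc) (opp (ρ a)) (opp (shift ρ K m a)) where
  closed y hy z hz := reach_trans hm hy ⟨r, hr ▸ hz⟩
  mem_iff y t := by
    constructor
    · intro h
      obtain ⟨⟨_, z, c', hz, rfl⟩, ht⟩ : ∃ t', t' = t := ⟨t, rfl⟩
      subst ht
      obtain ⟨w, hw, hzw, hwy⟩ := exists_of_mem_shift hρ hm hz h.1
      have hopp : (w, z) ∈ ρ r := hr ▸ mem_opp_of_mk_mem_opp hρ hm hid hK hK₂ hz hw hzw (hwy ▸ h)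
      have hs := mk_mem_shift hρ hm hw hz hopp
      rw [hwy] at hs
      obtain ⟨s, hs', hys, hst⟩ := exists_of_mem_shift hρ hm (hc.mono (reach_trans hm y.2)) hs
      exact ⟨⟨s, reach_trans hm y.2 ⟨r, hys⟩⟩, hr ▸ hys, hst⟩
    · rintro ⟨z, hz, rfl⟩
      refine ⟨mk_mem_shift hρ hm (hc.mono (reach_trans hm z.2)) (hc.mono (reach_trans hm y.2)) hz.1,
        ?_⟩
      rintro ⟨_, s, c', hs, rfl⟩ h
      obtain ⟨w, hw, hsw, hwy⟩ := exists_of_mem_shift hρ hm hs h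
      have hyz := mk_mem_shift hρ hm (hc.mono (reach_trans hm y.2)) (hc.mono (reach_trans hm z.2))
        (hr ▸ hz : (y.1, z.1) ∈ ρ r)
      have hyz' : (Coloured.mk hw, Coloured.lift hm hc z) ∈ shift ρ K m r := hwy ▸ hyz
      -- The point `w` shares the record of `y`, so it also has an `r`-image `q`. This makes `q` the
      -- only preimage of `w` under `ρ a`, hence equal to `s`.
      obtain ⟨q, hq, hwq, hqz⟩ := exists_of_mem_shift hρ hm hw hyz'
      rw [← hqz]
      obtain rfl : q = s := by
        rw [hr] at hwq
        exact hwq.2 _ hsw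
      rfl

end Colouring

/-! ### The finite base and its size. -/

section FiniteBase

variable {σ : Finset Op} {A : Type v} {X : Type u} {𝔄 : Alg σ A}

/-- Domains and ranges supply local identities even when `id` is not in the signature. -/
theorem Alg.IsRep.exists_ident (hσ : ({.comp, .meet, .dom, .ran} : Finset Op) ⊆ σ)
    {ρ : A → Set (X × X)} (h : 𝔄.IsRep ρ) (x : X) : ∃ a, (x, x) ∈ ρ a ∧ ρ a ⊆ PFRep.ident := by
  obtain ⟨a, ⟨y, hy⟩ | ⟨y, hy⟩⟩ := h.base x
  · refine ⟨𝔄.op .dom (hσ (by simp)) (fun _ => a), ?_, ?_⟩ <;> rw [h.map_op]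
    exacts [⟨rfl, y, hy⟩, fun p hp => hp.1]
  · refine ⟨𝔄.op .ran (hσ (by simp)) (fun _ => a), ?_, ?_⟩ <;> rw [h.map_op]
    exacts [⟨rfl, y, hy⟩, fun p hp => hp.1]

theorem Alg.IsRep.shift [Finite A] {K : Type} [Fintype K] [Nonempty K]
    (hσ : ({.comp, .meet, .dom, .ran} : Finset Op) ⊆ σ) {ρ : A → Set (X × X)} (h : 𝔄.IsRep ρ)
    (hK : Nat.card A ≤ Fintype.card K) (hK₂ : 2 ≤ Nat.card A → Nat.card A < Fintype.card K) :
    ∃ ρ' : A → Set (Coloured ρ K × Coloured ρ K), 𝔄.IsRep ρ' := by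
  have hρ := h.isPartialFunction
  have hcomp : Op.comp ∈ σ := hσ (by simp)
  set m : A → A → A := fun a b => 𝔄.op .comp hcomp (![a, b] : Fin 2 → A)
  have hm (a b : A) : ρ (m a b) = PFRep.comp (ρ a) (ρ b) := h.map_op .comp hcomp _
  have hid := h.exists_ident hσ
  have hsim (s : Op) (hs : s ∈ σ) (a : Fin s.arity → A) {x : X} {c : X → K}
      (hc : (reach ρ x).InjOn c) : Simulates (Coloured.lift hm hc) (ρ (𝔄.op s hs a))
        (interp s fun i => PFRep.shift ρ K m (a i)) := by
    rw [h.map_op]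
    by_cases hs₁ : s = .ran
    · subst hs₁
      exact simulates_ran hρ hm hK hc (h.map_op .ran hs a)
    by_cases hs₂ : s = .opp
    · subst hs₂
      exact simulates_opp hρ hm hid hK hK₂ hc (h.map_op .opp hs a)
    exact .interp (lift_injective hρ hm hid hc) s hs₁ hs₂ fun i => simulates_shift hρ hm hc (a i)
  refine ⟨PFRep.shift ρ K m, ?_, isPartialFunction_shift, fun s hs a => ?_, ?_⟩
  · have key (a b : A) (hab : PFRep.shift ρ K m a = PFRep.shift ρ K m b) : ρ a ⊆ ρ b := by
      rintro ⟨x, y⟩ hxy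
      obtain ⟨c, hc⟩ := exists_injOn_reach (K := K) hρ hK x
      have hy : y ∈ reach ρ x := ⟨a, hxy⟩
      have h1 := ((simulates_shift hρ hm hc a).mem_iff ⟨x, mem_reach_self hid x⟩ _).2
        ⟨⟨y, hy⟩, hxy, rfl⟩
      rw [hab] at h1
      obtain ⟨z, hz, hzy⟩ := ((simulates_shift hρ hm hc b).mem_iff _ _).1 h1
      obtain rfl := lift_injective hρ hm hid hc hzy
      exact hz
    exact fun a b hab => h.injective ((key a b hab).antisymm (key b a hab.symm))
  -- Every new point lies above some `x`; the simulations of both sides there have the same source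
  -- relation, so the two targets agree.
  · ext ⟨⟨_, x, c, hc, rfl⟩, t⟩
    exact ((simulates_shift hρ hm hc _).mem_iff ⟨x, mem_reach_self hid x⟩ t).trans
      ((hsim s hs a hc).mem_iff ⟨x, mem_reach_self hid x⟩ t).symm
  · rintro ⟨_, x, c, hc, rfl⟩
    obtain ⟨a, ha, -⟩ := hid x
    exact ⟨a, .inl ⟨_, mk_mem_shift hρ hm hc hc ha⟩⟩

/-- A bound for the size of the base in terms of the size of the algebra. -/
def baseBound (n : ℕ) : ℕ := (2 * n) ^ n - 1

theorem Alg.IsRep.card_coloured_le [Finite A] {K : Type} [Fintype K]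
    (hσ : ({.comp, .meet, .dom, .ran} : Finset Op) ⊆ σ) {ρ : A → Set (X × X)} (h : 𝔄.IsRep ρ) :
    Finite (Coloured ρ K) ∧
      Nat.card (Coloured ρ K) ≤ (Fintype.card K + 1) ^ Nat.card A - 1 := by
  classical
  have := Fintype.ofFinite A
  have hfin : Finite (Coloured ρ K) := inferInstanceAs (Finite {y : A → Option K // _})
  have := Fintype.ofFinite (Coloured ρ K)
  have hcard : Fintype.card (A → Option K) = (Fintype.card K + 1) ^ Nat.card A := by
    simp
  refine ⟨hfin, ?_⟩
  rw [← hcard, Nat.card_eq_fintype_card]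
  -- The record that is `none` everywhere never occurs, since each point has a local identity.
  refine Nat.le_sub_one_of_lt (Fintype.card_lt_of_injective_of_notMem
    (Subtype.val : Coloured ρ K → A → Option K) Subtype.val_injective (b := fun _ => none) ?_)
  rintro ⟨⟨_, x, c, hc, rfl⟩, hy⟩
  obtain ⟨a, ha, -⟩ := h.exists_ident hσ x
  have : colouring ρ c x a = none := congrFun hy a
  rw [colouring_of_mem h.isPartialFunction ha] at this
  cases this

theorem Alg.Representable.exists_fin [Finite A] [Nonempty A]
    (hσ : ({.comp, .meet, .dom, .ran} : Finset Op) ⊆ σ) (h : Alg.Representable.{u} 𝔄) :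
    ∃ k ≤ baseBound (Nat.card A), 𝔄.RepresentableOver (Fin k) := by
  obtain ⟨X, hX⟩ := h
  obtain ⟨ρ, hρ⟩ := Alg.representableOver_iff.1 hX
  have hn : 0 < Nat.card A := Nat.card_pos
  -- The number `2n - 1` is at least `n`, and exceeds `n` once `n ≥ 2`. For `n = 1` it is `1`, so
  -- the base has at most one point, as the required bound `1` demands.
  have : Nonempty (Fin (2 * Nat.card A - 1)) := ⟨⟨0, by omega⟩⟩
  obtain ⟨ρ', hρ'⟩ := hρ.shift (K := Fin (2 * Nat.card A - 1)) hσ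
    (by rw [Fintype.card_fin]; omega) (by rw [Fintype.card_fin]; omega)
  obtain ⟨hfin, hcard⟩ := hρ.card_coloured_le (K := Fin (2 * Nat.card A - 1)) hσ
  rw [Fintype.card_fin, Nat.sub_add_cancel (by omega)] at hcard
  exact ⟨_, hcard, (Alg.representableOver_iff.2 ⟨ρ', hρ'⟩).of_equiv (Finite.equivFin _).symm⟩

/-- For `n ≥ 2`, `(2n)^n ≤ n^(2n)` and `2n ≤ n^2 ≤ n^(2√n)`; this gives `C = 2`. -/
theorem baseBound_le {n : ℕ} (hn : 1 ≤ n) :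
    (baseBound n : ℝ) ≤ (n : ℝ) ^ ((n : ℝ) ^ (2 * √(n : ℝ))) := by
  rcases hn.eq_or_lt with rfl | hn
  · simp [baseBound]
  have hn' : (2 : ℝ) ≤ n := by exact_mod_cast hn
  have h1 : (1 : ℝ) ≤ √(n : ℝ) := Real.one_le_sqrt.2 (by linarith)
  have h2 : (2 * n : ℝ) ≤ (n : ℝ) ^ (2 * √(n : ℝ)) := calc
    (2 * n : ℝ) ≤ (n : ℝ) ^ (2 : ℝ) := by
      rw [Real.rpow_two]; nlinarith
    _ ≤ _ := Real.rpow_le_rpow_of_exponent_le (by linarith) (by linarith)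
  calc (baseBound n : ℝ) ≤ ((2 * n) ^ n : ℕ) := by exact_mod_cast Nat.sub_le _ _
    _ = (2 * n : ℝ) ^ n := by push_cast; rfl
    _ ≤ ((n : ℝ) ^ 2) ^ n := by gcongr; nlinarith
    _ = (n : ℝ) ^ (2 * n : ℝ) := by
      rw [← pow_mul, ← Real.rpow_natCast]; push_cast; rfl
    _ ≤ _ := Real.rpow_le_rpow_of_exponent_le (by linarith) h2

end FiniteBase

/-! ### Primitive recursive predicates and bounded quantifiers. -/

section Primrec

variable {α : Type} [Primcodable α]

attribute [fun_prop] Primrec Primrec.id Primrec.const Primrec.comp Primrec.fst Primrec.snd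
  Primrec.pair

@[fun_prop]
theorem primrec_add {f g : α → ℕ} (hf : Primrec f) (hg : Primrec g) :
    Primrec fun a => f a + g a :=
  Primrec.nat_add.comp hf hg

@[fun_prop]
theorem primrec_sub {f g : α → ℕ} (hf : Primrec f) (hg : Primrec g) :
    Primrec fun a => f a - g a :=
  Primrec.nat_sub.comp hf hg

@[fun_prop]
theorem primrec_mul {f g : α → ℕ} (hf : Primrec f) (hg : Primrec g) :
    Primrec fun a => f a * g a :=
  Primrec.nat_mul.comp hf hg

@[fun_prop]
theorem primrec_div {f g : α → ℕ} (hf : Primrec f) (hg : Primrec g) :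
    Primrec fun a => f a / g a :=
  Primrec.nat_div.comp hf hg

@[fun_prop]
theorem primrec_mod {f g : α → ℕ} (hf : Primrec f) (hg : Primrec g) :
    Primrec fun a => f a % g a :=
  Primrec.nat_mod.comp hf hg

@[fun_prop]
theorem primrec_pow {f g : α → ℕ} (hf : Primrec f) (hg : Primrec g) :
    Primrec fun a => f a ^ g a :=
  (Primrec₂.unpaired'.1 Nat.Primrec.pow).comp hf hg

@[fun_prop]
theorem primrec_natPair {f g : α → ℕ} (hf : Primrec f) (hg : Primrec g) :
    Primrec fun a => Nat.pair (f a) (g a) :=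
  Primrec₂.natPair.comp hf hg

@[fun_prop]
theorem primrec_getD {β : Type} [Primcodable β] {f : α → List β} {g : α → ℕ} (d : β)
    (hf : Primrec f) (hg : Primrec g) : Primrec fun a => (f a).getD (g a) d :=
  (Primrec.list_getD d).comp hf hg

theorem primrecPred_const (p : Prop) : PrimrecPred fun _ : α => p := by
  classical
  exact ⟨fun _ => Classical.dec p, Primrec.const _⟩

theorem primrecPred_bex {n : α → ℕ} {p : α → ℕ → Prop} (hn : Primrec n)
    (hp : PrimrecPred fun q : α × ℕ => p q.1 q.2) : PrimrecPred fun a => ∃ x < n a, p a x :=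
  ((PrimrecRel.exists_mem_list (R := fun (x : ℕ) (a : α) => p a x)
    (hp.comp (Primrec.pair Primrec.snd Primrec.fst)).primrecRel).comp
    (Primrec.list_range.comp hn) Primrec.id).of_eq fun _ => by simp

theorem primrecPred_ball {n : α → ℕ} {p : α → ℕ → Prop} (hn : Primrec n)
    (hp : PrimrecPred fun q : α × ℕ => p q.1 q.2) : PrimrecPred fun a => ∀ x < n a, p a x :=
  ((PrimrecRel.forall_mem_list (R := fun (x : ℕ) (a : α) => p a x)
    (hp.comp (Primrec.pair Primrec.snd Primrec.fst)).primrecRel).comp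
    (Primrec.list_range.comp hn) Primrec.id).of_eq fun _ => by simp

theorem primrecPred_imp {p q : α → Prop} (hp : PrimrecPred p) (hq : PrimrecPred q) :
    PrimrecPred fun a => p a → q a :=
  (hp.not.or hq).of_eq fun _ => imp_iff_not_or.symm

theorem primrecPred_iff {p q : α → Prop} (hp : PrimrecPred p) (hq : PrimrecPred q) :
    PrimrecPred fun a => p a ↔ q a :=
  ((primrecPred_imp hp hq).and (primrecPred_imp hq hp)).of_eq fun _ => iff_def.symm

theorem primrecPred_eq {β : Type} [Primcodable β] {f g : α → β} (hf : Primrec f)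
    (hg : Primrec g) : PrimrecPred fun a => f a = g a :=
  Primrec.eq.comp hf hg

theorem primrecPred_lt {f g : α → ℕ} (hf : Primrec f) (hg : Primrec g) :
    PrimrecPred fun a => f a < g a :=
  Primrec.nat_lt.comp hf hg

theorem primrecPred_forall_mem {β : Type*} (l : List β) {p : β → α → Prop}
    (hp : ∀ b, PrimrecPred (p b)) : PrimrecPred fun a => ∀ b ∈ l, p b a := by
  induction l with
  | nil => exact (primrecPred_const True).of_eq fun a => by simp
  | cons b l ih => exact ((hp b).and ih).of_eq fun a => by simp

/-- The `i`-th binary digit of `w` is `1`. -/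
def Bit (w i : ℕ) : Prop := w / 2 ^ i % 2 = 1

theorem primrecPred_bit {f g : α → ℕ} (hf : Primrec f) (hg : Primrec g) :
    PrimrecPred fun a => Bit (f a) (g a) :=
  primrecPred_eq (by fun_prop) (by fun_prop)

theorem exists_bit_iff (p : ℕ → Prop) (n : ℕ) : ∃ w < 2 ^ n, ∀ i < n, Bit w i ↔ p i := by
  classical
  refine ⟨Nat.ofBits fun i : Fin n => decide (p i), Nat.ofBits_lt_two_pow _, fun i hi => ?_⟩
  have := Nat.testBit_ofBits_lt (fun i : Fin n => decide (p i)) i hi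
  rw [Nat.testBit_eq_decide_div_mod_eq] at this
  simpa [Bit] using this

end Primrec

/-! ### The operations on a finite base as bounded formulas. -/

section Interpretation

/-- The interpretation of the operation symbols, on relations on the natural numbers below `k`,
by formulas with bounded quantifiers. -/
def natInterp (k : ℕ) (f : ℕ → ℕ → ℕ → Prop) (x y : ℕ) : Op → Prop
  | .comp => ∃ z < k, f 0 x z ∧ f 1 z y
  | .meet => f 0 x y ∧ f 1 x y
  | .dom => x = y ∧ ∃ z < k, f 0 x z
  | .ran => x = y ∧ ∃ z < k, f 0 z x
  | .zero => False
  | .ident => x = y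
  | .antidom => x = y ∧ ¬ ∃ z < k, f 0 x z
  | .fixset => x = y ∧ f 0 x x
  | .pref => f 0 x y ∨ (¬ ∃ z < k, f 0 x z) ∧ f 1 x y
  | .maxit => (¬ ∃ z < k, f 0 y z) ∧ ∀ S < 2 ^ k, Bit S x →
      (∀ u < k, ∀ v < k, Bit S u → f 0 u v → Bit S v) → Bit S y
  | .opp => f 0 y x ∧ ∀ z < k, f 0 z x → y = z

theorem primrecPred_natInterp {α : Type} [Primcodable α] (s : Op) {k x y : α → ℕ}
    {f : α → ℕ → ℕ → ℕ → Prop} (hk : Primrec k) (hx : Primrec x) (hy : Primrec y)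
    (hf : ∀ j, PrimrecPred fun q : α × ℕ × ℕ => f q.1 j q.2.1 q.2.2) :
    PrimrecPred fun a => natInterp (k a) (f a) (x a) (y a) s := by
  have hf' {β : Type} [Primcodable β] (j : ℕ) {a : β → α} {u v : β → ℕ} (ha : Primrec a)
      (hu : Primrec u) (hv : Primrec v) : PrimrecPred fun b => f (a b) j (u b) (v b) :=
    (hf j).comp (ha.pair (hu.pair hv))
  have hxy := primrecPred_eq hx hy
  have hdom : PrimrecPred fun a => ∃ z < k a, f a 0 (x a) z :=
    primrecPred_bex hk (hf' 0 (by fun_prop) (by fun_prop) (by fun_prop))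
  cases s with
  | comp =>
    exact primrecPred_bex hk ((hf' 0 (by fun_prop) (by fun_prop) (by fun_prop)).and
      (hf' 1 (by fun_prop) (by fun_prop) (by fun_prop)))
  | meet => exact (hf' 0 .id hx hy).and (hf' 1 .id hx hy)
  | dom => exact hxy.and hdom
  | ran =>
    exact hxy.and (primrecPred_bex hk (hf' 0 (by fun_prop) (by fun_prop) (by fun_prop)))
  | zero => exact primrecPred_const False
  | ident => exact hxy
  | antidom => exact hxy.and hdom.not
  | fixset => exact hxy.and (hf' 0 .id hx hx)
  | pref => exact (hf' 0 .id hx hy).or (hdom.not.and (hf' 1 .id hx hy))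
  | maxit =>
    refine (primrecPred_bex hk (hf' 0 (by fun_prop) (by fun_prop) (by fun_prop))).not.and
      (primrecPred_ball (by fun_prop) (primrecPred_imp (primrecPred_bit (by fun_prop)
        (by fun_prop)) (primrecPred_imp ?_ (primrecPred_bit (by fun_prop) (by fun_prop)))))
    exact primrecPred_ball (by fun_prop) (primrecPred_ball (by fun_prop) (primrecPred_imp
      (primrecPred_bit (by fun_prop) (by fun_prop)) (primrecPred_imp
        (hf' 0 (by fun_prop) (by fun_prop) (by fun_prop))
        (primrecPred_bit (by fun_prop) (by fun_prop)))))
  | opp =>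
    exact (hf' 0 .id hy hx).and (primrecPred_ball hk (primrecPred_imp
      (hf' 0 (by fun_prop) (by fun_prop) (by fun_prop))
      (primrecPred_eq (by fun_prop) (by fun_prop))))

variable {k : ℕ}

/-- The restriction to the natural numbers below `k` of a relation. -/
def finRel (k : ℕ) (f : ℕ → ℕ → Prop) : Set (Fin k × Fin k) := {p | f p.1 p.2}

/-- Being reachable by iterates of `f` means lying in every `f`-closed set that contains `x`. On `k`
points such sets are coded by numbers below `2 ^ k`, so the union over all `n` becomes a bounded
quantifier. -/
theorem mem_maxit_iff {f : ℕ → ℕ → Prop} {x y : Fin k} :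
    (x, y) ∈ maxit (finRel k f) ↔ (¬ ∃ z : Fin k, f y z) ∧ ∀ S < 2 ^ k, Bit S x →
      (∀ u : Fin k, ∀ v : Fin k, Bit S u → f u v → Bit S v) → Bit S y := by
  constructor
  · intro h
    obtain ⟨n, z, hz, hzy, hy⟩ := Set.mem_iUnion.1 h
    obtain rfl : z = y := hzy
    refine ⟨hy, fun S _ hx hS => ?_⟩
    induction n generalizing x with
    | zero => exact (show x = z from hz) ▸ hx
    | succ n ih =>
      obtain ⟨t, ht, htz⟩ := hz
      exact ih (Set.mem_iUnion.2 ⟨n, z, htz, rfl, hy⟩) htz hy (hS _ _ hx ht)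
  · rintro ⟨hy, h⟩
    -- The closed set to test is the set of points reachable from `x`.
    obtain ⟨S, hSk, hS⟩ := exists_bit_iff (fun i => ∃ (n : ℕ) (z : Fin k),
      z = i ∧ (x, z) ∈ iter (finRel k f) n) k
    -- `iter` adds steps at the front, whereas closure of `S` needs a step added at the end.
    have hiter (n : ℕ) : ∀ (x z t : Fin k), (x, z) ∈ iter (finRel k f) n → f z t →
        (x, t) ∈ iter (finRel k f) (n + 1) := by
      induction n with
      | zero =>
        intro x z t hz ht
        obtain rfl : x = z := hz
        exact ⟨t, ht, rfl⟩
      | succ n ih =>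
        rintro x z t ⟨w, hw, hz⟩ ht
        exact ⟨w, hw, ih _ _ _ hz ht⟩
    obtain ⟨n, z, hz, hn⟩ := (hS y y.2).1 (h S hSk ((hS x x.2).2 ⟨0, x, rfl, rfl⟩) (by
      intro u v hu huv
      obtain ⟨n, z, hz, hn⟩ := (hS u u.2).1 hu
      obtain rfl := Fin.ext hz
      exact (hS v v.2).2 ⟨n + 1, v, rfl, hiter n _ _ _ hn huv⟩))
    obtain rfl := Fin.ext hz
    exact Set.mem_iUnion.2 ⟨n, z, hn, rfl, hy⟩

theorem mem_interp_finRel_iff (s : Op) (f : ℕ → ℕ → ℕ → Prop) (x y : Fin k) :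
    (x, y) ∈ interp s (fun i : Fin s.arity => finRel k (f i)) ↔ natInterp k f x y s := by
  cases s
  case maxit =>
    simpa [natInterp, Fin.forall_iff] using! mem_maxit_iff (f := f 0) (x := x) (y := y)
  case comp =>
    simp [interp, comp, finRel, natInterp, Fin.exists_iff]
    grind
  all_goals
    simp [interp, dom, ran, ident, antidom, fixset, pref, opp, finRel, natInterp,
      Fin.exists_iff, Fin.forall_iff, Fin.ext_iff]

end Interpretation

/-! ### Codes of algebras and representations, and the decision procedure. -/

section Codes

/-- The entry in position `i` of the table of `s` in a code. -/
def entry (c : ℕ × List (List ℕ)) (s : Op) (i : ℕ) : ℕ :=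
  (c.2.getD (Op.all.idxOf s) []).getD i 0

/-- `c` has the form of a code of a finite `σ`-algebra. -/
def IsCode (σ : Finset Op) (c : ℕ × List (List ℕ)) : Prop :=
  0 < c.1 ∧ c.2.length = Op.all.length ∧ ∀ s ∈ Op.all,
    (s ∈ σ → (c.2.getD (Op.all.idxOf s) []).length = c.1 ^ s.arity ∧
      ∀ i < c.1 ^ s.arity, entry c s i < c.1) ∧
    (s ∉ σ → c.2.getD (Op.all.idxOf s) [] = [])

/-- The relation with number `a` among those coded by the binary digits of `w`. -/
def BitRel (w a x y : ℕ) : Prop := Bit w (Nat.pair a (Nat.pair x y))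

/-- `w` codes a representation over the natural numbers below `k` of the algebra with code `c`. -/
def IsRepCode (σ : Finset Op) (c : ℕ × List (List ℕ)) (k w : ℕ) : Prop :=
  (∀ a < c.1, ∀ b < c.1, (∀ x < k, ∀ y < k, BitRel w a x y ↔ BitRel w b x y) → a = b) ∧
  (∀ a < c.1, ∀ x < k, ∀ y < k, ∀ z < k, BitRel w a x y → BitRel w a x z → y = z) ∧
  (∀ s ∈ Op.all, s ∈ σ → ∀ i < c.1 ^ s.arity, ∀ x < k, ∀ y < k,
    BitRel w (entry c s i) x y ↔ natInterp k (fun j => BitRel w (i / c.1 ^ j % c.1)) x y s) ∧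
  ∀ x < k, ∃ a < c.1, ∃ y < k, BitRel w a x y ∨ BitRel w a y x

theorem Op.mem_all (s : Op) : s ∈ Op.all := by cases s <;> simp [Op.all]

section

variable {α : Type} [Primcodable α]

@[fun_prop]
theorem primrec_entry {c : α → ℕ × List (List ℕ)} {i : α → ℕ} (hc : Primrec c) (hi : Primrec i)
    (s : Op) : Primrec fun a => entry (c a) s (i a) := by
  unfold entry
  fun_prop

theorem primrecPred_bitRel {w a x y : α → ℕ} (hw : Primrec w) (ha : Primrec a) (hx : Primrec x)
    (hy : Primrec y) : PrimrecPred fun t => BitRel (w t) (a t) (x t) (y t) :=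
  primrecPred_bit (by fun_prop) (by fun_prop)

theorem primrecPred_isCode (σ : Finset Op) : PrimrecPred (IsCode σ) := by
  have hlen {f : ℕ × List (List ℕ) → List ℕ} (hf : Primrec f) :
      Primrec fun c => (f c).length := Primrec.list_length.comp hf
  refine (primrecPred_lt (by fun_prop) (by fun_prop)).and
    ((primrecPred_eq (Primrec.list_length.comp .snd) (by fun_prop)).and
    (primrecPred_forall_mem _ fun s => (primrecPred_imp (primrecPred_const _) ?_).and
      (primrecPred_imp (primrecPred_const _) (primrecPred_eq (by fun_prop) (by fun_prop)))))
  exact (primrecPred_eq (hlen (by fun_prop)) (by fun_prop)).and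
    (primrecPred_ball (by fun_prop) (primrecPred_lt (by fun_prop) (by fun_prop)))

theorem primrecPred_isRepCode (σ : Finset Op) {c : α → ℕ × List (List ℕ)} {k w : α → ℕ}
    (hc : Primrec c) (hk : Primrec k) (hw : Primrec w) :
    PrimrecPred fun a => IsRepCode σ (c a) (k a) (w a) := by
  refine .and ?_ (.and ?_ (.and ?_ ?_))
  · exact primrecPred_ball (by fun_prop) (primrecPred_ball (by fun_prop) (primrecPred_imp
      (primrecPred_ball (by fun_prop) (primrecPred_ball (by fun_prop) (primrecPred_iff
        (primrecPred_bitRel (by fun_prop) (by fun_prop) (by fun_prop) (by fun_prop))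
        (primrecPred_bitRel (by fun_prop) (by fun_prop) (by fun_prop) (by fun_prop)))))
      (primrecPred_eq (by fun_prop) (by fun_prop))))
  · exact primrecPred_ball (by fun_prop) (primrecPred_ball (by fun_prop) (primrecPred_ball
      (by fun_prop) (primrecPred_ball (by fun_prop) (primrecPred_imp
        (primrecPred_bitRel (by fun_prop) (by fun_prop) (by fun_prop) (by fun_prop))
        (primrecPred_imp
          (primrecPred_bitRel (by fun_prop) (by fun_prop) (by fun_prop) (by fun_prop))
          (primrecPred_eq (by fun_prop) (by fun_prop)))))))
  · exact primrecPred_forall_mem _ fun s => primrecPred_imp (primrecPred_const _)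
      (primrecPred_ball (by fun_prop) (primrecPred_ball (by fun_prop) (primrecPred_ball
        (by fun_prop) (primrecPred_iff
          (primrecPred_bitRel (by fun_prop) (by fun_prop) (by fun_prop) (by fun_prop))
          (primrecPred_natInterp s (by fun_prop) (by fun_prop) (by fun_prop) fun j =>
            primrecPred_bitRel (by fun_prop) (by fun_prop) (by fun_prop) (by fun_prop))))))
  · exact primrecPred_ball (by fun_prop) (primrecPred_bex (by fun_prop) (primrecPred_bex
      (by fun_prop)
      ((primrecPred_bitRel (by fun_prop) (by fun_prop) (by fun_prop) (by fun_prop)).or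
        (primrecPred_bitRel (by fun_prop) (by fun_prop) (by fun_prop) (by fun_prop)))))

@[fun_prop]
theorem primrec_baseBound {f : α → ℕ} (hf : Primrec f) : Primrec fun a => baseBound (f a) := by
  unfold baseBound
  fun_prop

end

variable {σ : Finset Op}

theorem FinAlg.getD_code (𝔄 : FinAlg σ) (s : Op) :
    𝔄.code.2.getD (Op.all.idxOf s) [] = 𝔄.table s := by
  cases s <;> rfl

theorem FinAlg.entry_code (𝔄 : FinAlg σ) {s : Op} (hs : s ∈ σ)
    (i : Fin ((𝔄.n + 1) ^ s.arity)) :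
    entry 𝔄.code s i = 𝔄.alg.op s hs (finFunctionFinEquiv.symm i) := by
  rw [entry, getD_code]
  simp [table, hs]

theorem FinAlg.isCode_code (𝔄 : FinAlg σ) : IsCode σ 𝔄.code := by
  refine ⟨Nat.succ_pos _, by simp [code], fun s _ => ⟨fun hs => ⟨?_, fun i hi => ?_⟩, fun hs => ?_⟩⟩
  · rw [getD_code]
    simp [table, hs, code]
  · rw [𝔄.entry_code hs ⟨i, hi⟩]
    exact Fin.is_lt _
  · rw [getD_code]
    simp [table, hs]

theorem IsCode.exists_code_eq {c : ℕ × List (List ℕ)} (h : IsCode σ c) :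
    ∃ 𝔄 : FinAlg σ, 𝔄.code = c := by
  obtain ⟨m, l⟩ := c
  obtain ⟨hm, hl, hs⟩ := h
  obtain ⟨n, rfl⟩ : ∃ n, m = n + 1 := ⟨m - 1, (Nat.sub_add_cancel hm).symm⟩
  let 𝔄 : FinAlg σ := ⟨n, ⟨fun s h a => ⟨entry (n + 1, l) s (finFunctionFinEquiv a),
    ((hs s s.mem_all).1 h).2 _ (Fin.is_lt _)⟩⟩⟩
  have htable (s : Op) : 𝔄.table s = l.getD (Op.all.idxOf s) [] := by
    by_cases h : s ∈ σ
    · refine List.ext_getElem ?_ fun i h₁ h₂ => ?_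
      · rw [((hs s s.mem_all).1 h).1]
        simp [FinAlg.table, h, 𝔄]
      · rw [← List.getD_eq_getElem _ 0 h₂]
        simp [FinAlg.table, h, 𝔄, entry]
    · rw [((hs s s.mem_all).2 h)]
      simp [FinAlg.table, h]
  refine ⟨𝔄, Prod.ext rfl (List.ext_getElem (by simp [FinAlg.code, hl]) fun i h₁ h₂ => ?_)⟩
  have hi : i < Op.all.length := hl ▸ h₂
  have hnodup : Op.all.Nodup := by decide
  simp only [FinAlg.code, List.getElem_map, htable, hnodup.idxOf_getElem]
  exact List.getD_eq_getElem _ _ h₂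

theorem FinAlg.isRepCode_iff (𝔄 : FinAlg σ) (k w : ℕ) :
    IsRepCode σ 𝔄.code k w ↔ 𝔄.alg.IsRep fun a => finRel k (BitRel w a) := by
  -- A table position lists its arguments as base-`(n + 1)` digits, which is how
  -- `finFunctionFinEquiv` numbers tuples.
  have hop (s : Op) (hs : s ∈ σ) (i : Fin ((𝔄.n + 1) ^ s.arity)) (x y : Fin k) :
      (BitRel w (entry 𝔄.code s i) x y ↔
        natInterp k (fun j => BitRel w (i / (𝔄.n + 1) ^ j % (𝔄.n + 1))) x y s) ↔
      ((x, y) ∈ finRel k (BitRel w (𝔄.alg.op s hs (finFunctionFinEquiv.symm i))) ↔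
        (x, y) ∈ interp s fun j => finRel k (BitRel w (finFunctionFinEquiv.symm i j))) := by
    rw [𝔄.entry_code hs, ← mem_interp_finRel_iff]
    simp [finRel]
  constructor
  · rintro ⟨h₁, h₂, h₃, h₄⟩
    refine ⟨fun a b hab => ?_, fun a x y z hy hz => ?_, fun s hs a => ?_, fun x => ?_⟩
    · refine Fin.ext (h₁ a a.2 b b.2 fun x hx y hy => ?_)
      exact Set.ext_iff.1 hab (⟨x, hx⟩, ⟨y, hy⟩)
    · exact Fin.ext (h₂ a a.2 x x.2 y y.2 z z.2 hy hz)
    · obtain ⟨i, rfl⟩ := finFunctionFinEquiv.symm.surjective a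
      ext ⟨x, y⟩
      exact (hop s hs i x y).1 (h₃ s s.mem_all hs i i.2 x x.2 y y.2)
    · obtain ⟨a, ha, y, hy, h⟩ := h₄ x x.2
      exact ⟨⟨a, ha⟩, h.imp (fun h => ⟨⟨y, hy⟩, h⟩) fun h => ⟨⟨y, hy⟩, h⟩⟩
  · rintro ⟨h₁, h₂, h₃, h₄⟩
    refine ⟨fun a ha b hb hab => ?_, fun a ha x hx y hy z hz hxy hxz => ?_,
      fun s _ hs i hi x hx y hy => ?_, fun x hx => ?_⟩
    · refine congrArg Fin.val (h₁ (a₁ := ⟨a, ha⟩) (a₂ := ⟨b, hb⟩) ?_)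
      ext ⟨x, y⟩
      exact hab x x.2 y y.2
    · exact congrArg Fin.val (h₂ ⟨a, ha⟩ ⟨x, hx⟩ ⟨y, hy⟩ ⟨z, hz⟩ hxy hxz)
    · refine (hop s hs ⟨i, hi⟩ ⟨x, hx⟩ ⟨y, hy⟩).2 ?_
      rw [h₃]
    · obtain ⟨a, ⟨y, h⟩ | ⟨y, h⟩⟩ := h₄ ⟨x, hx⟩
      exacts [⟨a, a.2, y, y.2, .inl h⟩, ⟨a, a.2, y, y.2, .inr h⟩]

theorem FinAlg.exists_isRepCode_iff (𝔄 : FinAlg σ) (k : ℕ) :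
    (∃ w < 2 ^ Nat.pair 𝔄.code.1 (Nat.pair k k), IsRepCode σ 𝔄.code k w) ↔
      𝔄.alg.RepresentableOver (Fin k) := by
  rw [Alg.representableOver_iff]
  constructor
  · rintro ⟨w, -, hw⟩
    exact ⟨_, (𝔄.isRepCode_iff k w).1 hw⟩
  · rintro ⟨ρ, hρ⟩
    obtain ⟨w, hw, h⟩ := exists_bit_iff (fun i => ∃ (a : Fin (𝔄.n + 1)) (p : Fin k × Fin k),
      i = Nat.pair a (Nat.pair p.1 p.2) ∧ p ∈ ρ a) (Nat.pair 𝔄.code.1 (Nat.pair k k))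
    refine ⟨w, hw, (𝔄.isRepCode_iff k w).2 ?_⟩
    convert hρ with a
    ext ⟨x, y⟩
    refine (h _ ?_).trans ⟨?_, fun hxy => ⟨a, (x, y), rfl, hxy⟩⟩
    -- Pairing is strictly monotone in each argument, so every relevant digit position is below the
    -- stated number of digits.
    · exact (Nat.pair_lt_pair_left _ a.2).trans (Nat.pair_lt_pair_right _
        ((Nat.pair_lt_pair_left _ x.2).trans (Nat.pair_lt_pair_right _ y.2)))
    · rintro ⟨b, ⟨x', y'⟩, hb, hxy⟩
      simp only [Nat.pair_eq_pair, Fin.val_inj] at hb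
      obtain ⟨rfl, rfl, rfl⟩ := hb
      exact hxy

/-- The bound on the base makes the search over `k` and `w` finite, so the predicate is even
primitive recursive. -/
theorem computablePred_representable (hσ : ({.comp, .meet, .dom, .ran} : Finset Op) ⊆ σ) :
    ComputablePred (fun c : ℕ × List (List ℕ) =>
      ∃ 𝔄 : FinAlg σ, 𝔄.code = c ∧ Alg.Representable.{u} 𝔄.alg) := by
  have h : PrimrecPred fun c : ℕ × List (List ℕ) => IsCode σ c ∧ ∃ k < baseBound c.1 + 1,
      ∃ w < 2 ^ Nat.pair c.1 (Nat.pair k k), IsRepCode σ c k w :=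
    (primrecPred_isCode σ).and (primrecPred_bex (by fun_prop) (primrecPred_bex (by fun_prop)
      (primrecPred_isRepCode σ (by fun_prop) (by fun_prop) (by fun_prop))))
  refine (h.of_eq fun c => ⟨?_, ?_⟩).computablePred
  · rintro ⟨hc, k, -, hk⟩
    obtain ⟨𝔄, rfl⟩ := hc.exists_code_eq
    -- The finite base is lifted to the universe in which representability is stated.
    exact ⟨𝔄, rfl, ULift.{u} (Fin k), ((𝔄.exists_isRepCode_iff k).1 hk).of_equiv Equiv.ulift⟩
  · rintro ⟨𝔄, rfl, h⟩
    obtain ⟨k, hk, hk'⟩ := h.exists_fin hσ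
    rw [Nat.card_fin] at hk
    exact ⟨𝔄.isCode_code, k, Nat.lt_succ_of_le hk, (𝔄.exists_isRepCode_iff k).2 hk'⟩

end Codes

end PFRep

theorem mainTheorem4 (σ : Finset PFRep.Op)
    (hσ : ({.comp, .meet, .dom, .ran} : Finset PFRep.Op) ⊆ σ) :
    ComputablePred (fun c : ℕ × List (List ℕ) =>
      ∃ 𝔄 : PFRep.FinAlg σ, 𝔄.code = c ∧ PFRep.Alg.Representable.{u} 𝔄.alg) ∧
    ∃ B : ℕ → ℕ, Computable B ∧
      (∃ C : ℝ, ∀ n : ℕ, 1 ≤ n → (B n : ℝ) ≤ (n : ℝ) ^ ((n : ℝ) ^ (C * √(n : ℝ)))) ∧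
      ∀ (A : Type v) [Finite A] [Nonempty A] (𝔄 : PFRep.Alg σ A),
        PFRep.Alg.Representable.{u} 𝔄 →
          ∃ k : ℕ, k ≤ B (Nat.card A) ∧ 𝔄.RepresentableOver (Fin k) :=
  ⟨PFRep.computablePred_representable hσ, PFRep.baseBound,
    (PFRep.primrec_baseBound .id).to_comp, ⟨2, fun _ => PFRep.baseBound_le⟩,
    fun _ _ _ _ h => h.exists_fin hσ⟩
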